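/- Let $k$ be a unital commutative ring, $X$ a set and $\Omega$ a semigroup. Operations on $k$-modules are bilinear. **Rota–Baxter family algebras.** A Rota–Baxter family algebra of weight $\lambda\in k$ is a unital associative $k$-algebra $R$ with linear maps $(P_\omega)_{\omega\in\Omega}$ such that $P_\alpha(a)P_\beta(b)=P_{\alpha\beta}\big(P_\alpha(a)b+aP_\beta(b)+\lambda ab\big)$. **Tridendriform family algebras.** A tridendriform family algebra is a $k$-module with operations $(\prec_\omega,\succ_\omega)_{\omega\in\Omega}$ and $\cdot$ such that $(x\prec_\alpha y)\prec_\beta z=x\prec_{\alpha\beta}(y\prec_\beta z+y\succ_\alpha z+y\cdot z)$, $(x\succ_\alpha y)\prec_\beta z=x\succ_\alpha(y\prec_\beta z)$, $(x\prec_\beta y+x\succ_\alpha y+x\cdot y)\succ_{\alpha\beta}z=x\succ_\alpha(y\succ_\beta z)$, $(x\succ_\alpha y)\cdot z=x\succ_\alpha(y\cdot z)$, $(x\prec_\alpha y)\cdot z=x\cdot(y\succ_\alpha z)$, $(x\cdot y)\prec_\alpha z=x\cdot(y\prec_\alpha z)$, $(x\cdot y)\cdot z=x\cdot(y\cdot z)$.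 **Trees.** Let $\mathcal T$ be the set of planar rooted trees with at least one vertex, whose angles (pairs of adjacent incoming edges of a vertex) are decorated by $X$ and whose internal edges are typed by $\Omega$. The leaves and the root are edges without type. Let $\bullet$ be the tree with one vertex and one leaf. For $x\in X$ let $Y_x$ be the tree with one vertex, two leaves and angle $x$. Let $B^+_\omega(T)$ be obtained by grafting $T$ on a new root by an internal edge of type $\omega$; extend $B^+_\omega$ linearly to $k\mathcal T$. **The product $\diamond$.** For $\lambda\in k$ let $\diamond=\diamond_\lambda$ be the bilinear product on $k\mathcal T$ defined recursively as follows. In $T\diamond T'$ the roots are identified, and the last incoming edge of the root of $T$ and the first incoming edge of the root of $T'$ are merged. If one of them is a leaf, the other one is kept. If they are internal edges of types $\alpha,\beta$ carrying trees $S,S'$, they become one edge of type $\alpha\beta$ carrying $B^+_\alpha(S)\diamond S'+S\diamond B^+_\beta(S')+\lambda\, S\diamond S'$ (expanded linearly). **Schröder trees.** Let $\mathcal S\subset\mathcal T$ be the set of Schröder trees (every vertex has at least two incoming edges). On $\mathrm{DT}(X,\Omega):=k\mathcal S$ define bilinear operations recursively. For $T,U\in\mathcal S$: * $T\prec_\omega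 U$ is obtained by replacing the last incoming edge of the root of $T$: a leaf becomes an edge of type $\omega$ carrying $U$, and an edge of type $\alpha$ carrying $S$ becomes an edge of type $\alpha\omega$ carrying $S\succ_\alpha U+S\prec_\omega U+S\cdot U$. * $T\succ_\omega U$ is obtained by replacing the first incoming edge of the root of $U$: a leaf becomes an edge of type $\omega$ carrying $T$, and an edge of type $\beta$ carrying $V$ becomes an edge of type $\omega\beta$ carrying $T\succ_\omega V+T\prec_\beta V+T\cdot V$. * $T\cdot U$ is obtained by identifying the roots and merging the last incoming edge of $T$ with the first incoming edge of $U$: if one is a leaf the other is kept, and edges of types $\alpha,\beta$ carrying $S,V$ become an edge of type $\alpha\beta$ carrying $S\succ_\alpha V+S\prec_\beta V+S\cdot V$. **Theorem.** 1. $(k\mathcal T,\diamond_1,\bullet,(B^+_\omega)_{\omega})$ with $x\mapsto Y_x$ is the free Rota–Baxter family algebra of weight $1$ on $X$, and $(\mathrm{DT}(X,\Omega),(\prec_\omega,\succ_\omega)_\omega,\cdot)$ with $x\mapsto Y_x$ is the free tridendriform family algebra on $X$. The operations $T\prec'_\omega U=T\diamond_1 B^+_\omega(U)$, $T\succ'_\omega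 U=B^+_\omega(T)\diamond_1 U$, $T\cdot' U=T\diamond_1 U$ make $k\mathcal T$ a tridendriform family algebra. The span $k\mathcal S$ of the Schröder trees is closed under them, and the canonical inclusion $j:\mathrm{DT}(X,\Omega)\to k\mathcal T$ is an injective morphism of tridendriform family algebras with image $k\mathcal S$ and $j(Y_x)=Y_x$. So the free tridendriform family algebra on $X$ is a tridendriform family subalgebra of the free Rota–Baxter family algebra of weight $1$ on $X$. 2. Let $\lambda\in k$ be invertible (any $\lambda\ne0$ if $k$ is a field). Then $(k\mathcal T,\diamond_\lambda,\bullet,(B^+_\omega)_\omega)$ with $x\mapsto Y_x$ is the free Rota–Baxter family algebra of weight $\lambda$ on $X$. The operations $T\prec'_\omega U=T\diamond_\lambda B^+_\omega(U)$, $T\succ'_\omega U=B^+_\omega(T)\diamond_\lambda U$, $T\cdot'U=\lambda\,T\diamond_\lambda U$ make $k\mathcal T$ a tridendriform family algebra, and $k\mathcal S$ is closed under them. The linear map $j_\lambda:\mathrm{DT}(X,\Omega)\to k\mathcal T$, $j_\lambda(T)=\lambda^{-|V(T)|}\,T$, where $|V(T)|$ is the number of vertices of $T\in\mathcal S$, is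 an injective morphism of tridendriform family algebras with image $k\mathcal S$, and $j_\lambda(Y_x)=\lambda^{-1}j(Y_x)$ for all $x\in X$. -/

import Mathlib

universe w

/-! # Abstract family algebras

All operations on a `k`-module are bilinear and are given as `k`-bilinear maps. -/

section Abstract

variable {k : Type*} [CommRing k] {Ω : Type*} [Semigroup Ω]

/-- A Rota-Baxter family algebra of weight `l`: a unital associative `k`-algebra (product `mul`,
unit `one`) with linear operators `P ω`, `ω ∈ Ω`, satisfying the Rota-Baxter family identity. -/
structure IsRotaBaxterFamilyAlgebra {A : Type*} [AddCommGroup A] [Module k A]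
    (l : k) (mul : A →ₗ[k] A →ₗ[k] A) (one : A) (P : Ω → A →ₗ[k] A) : Prop where
  mul_assoc : ∀ a b c, mul (mul a b) c = mul a (mul b c)
  one_mul : ∀ a, mul one a = a
  mul_one : ∀ a, mul a one = a
  rotaBaxter : ∀ (α β : Ω) (a b : A),
    mul (P α a) (P β b) = P (α * β) (mul (P α a) b + mul a (P β b) + l • mul a b)

/-- Morphisms of Rota-Baxter family algebras: unital algebra morphisms commuting with all the
operators. -/
structure IsRotaBaxterFamilyHom {A B : Type*} [AddCommGroup A] [Module k A]
    [AddCommGroup B] [Module k B]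
    (mulA : A →ₗ[k] A →ₗ[k] A) (oneA : A) (PA : Ω → A →ₗ[k] A)
    (mulB : B →ₗ[k] B →ₗ[k] B) (oneB : B) (PB : Ω → B →ₗ[k] B) (F : A →ₗ[k] B) : Prop where
  map_mul : ∀ a b, F (mulA a b) = mulB (F a) (F b)
  map_one : F oneA = oneB
  map_op : ∀ ω a, F (PA ω a) = PB ω (F a)

/-- `(A, mul, one, P)` together with `i : X → A` is the free Rota-Baxter family algebra of
weight `l` on `X`. -/
def IsFreeRotaBaxterFamilyAlgebra {X A : Type*} [AddCommGroup A] [Module k A]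
    (l : k) (mul : A →ₗ[k] A →ₗ[k] A) (one : A) (P : Ω → A →ₗ[k] A) (i : X → A) : Prop :=
  IsRotaBaxterFamilyAlgebra l mul one P ∧
  ∀ (R : Type w) [AddCommGroup R] [Module k R]
    (mulR : R →ₗ[k] R →ₗ[k] R) (oneR : R) (PR : Ω → R →ₗ[k] R),
    IsRotaBaxterFamilyAlgebra l mulR oneR PR →
    ∀ f : X → R, ∃! F : A →ₗ[k] R,
      IsRotaBaxterFamilyHom mul one P mulR oneR PR F ∧ ∀ x, F (i x) = f x

/-- A tridendriform family algebra: a `k`-module with operations `≺_ω`, `≻_ω` (`ω ∈ Ω`), `·`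
satisfying the seven axioms. -/
structure IsTridendriformFamilyAlgebra {D : Type*} [AddCommGroup D] [Module k D]
    (prec succ : Ω → D →ₗ[k] D →ₗ[k] D) (dot : D →ₗ[k] D →ₗ[k] D) : Prop where
  prec_prec : ∀ (α β : Ω) (x y z : D),
    prec β (prec α x y) z = prec (α * β) x (prec β y z + succ α y z + dot y z)
  succ_prec : ∀ (α β : Ω) (x y z : D), prec β (succ α x y) z = succ α x (prec β y z)
  succ_succ : ∀ (α β : Ω) (x y z : D),
    succ (α * β) (prec β x y + succ α x y + dot x y) z = succ α x (succ β y z)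
  succ_dot : ∀ (α : Ω) (x y z : D), dot (succ α x y) z = succ α x (dot y z)
  prec_dot : ∀ (α : Ω) (x y z : D), dot (prec α x y) z = dot x (succ α y z)
  dot_prec : ∀ (α : Ω) (x y z : D), prec α (dot x y) z = dot x (prec α y z)
  dot_dot : ∀ (x y z : D), dot (dot x y) z = dot x (dot y z)

/-- Morphisms of tridendriform family algebras. -/
structure IsTridendriformFamilyHom {D E : Type*} [AddCommGroup D] [Module k D]
    [AddCommGroup E] [Module k E]
    (precD succD : Ω → D →ₗ[k] D →ₗ[k] D) (dotD : D →ₗ[k] D →ₗ[k] D)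
    (precE succE : Ω → E →ₗ[k] E →ₗ[k] E) (dotE : E →ₗ[k] E →ₗ[k] E)
    (F : D →ₗ[k] E) : Prop where
  map_prec : ∀ ω a b, F (precD ω a b) = precE ω (F a) (F b)
  map_succ : ∀ ω a b, F (succD ω a b) = succE ω (F a) (F b)
  map_dot : ∀ a b, F (dotD a b) = dotE (F a) (F b)

/-- `(D, prec, succ, dot)` together with `i : X → D` is the free tridendriform family algebra
on `X`. -/
def IsFreeTridendriformFamilyAlgebra {X D : Type*} [AddCommGroup D] [Module k D]
    (prec succ : Ω → D →ₗ[k] D →ₗ[k] D) (dot : D →ₗ[k] D →ₗ[k] D) (i : X → D) : Prop :=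
  IsTridendriformFamilyAlgebra prec succ dot ∧
  ∀ (E : Type w) [AddCommGroup E] [Module k E]
    (precE succE : Ω → E →ₗ[k] E →ₗ[k] E) (dotE : E →ₗ[k] E →ₗ[k] E),
    IsTridendriformFamilyAlgebra precE succE dotE →
    ∀ f : X → E, ∃! F : D →ₗ[k] E,
      IsTridendriformFamilyHom prec succ dot precE succE dotE F ∧ ∀ x, F (i x) = f x

/-- A submodule closed under all the operations `≺_ω`, `≻_ω`, `·`. -/
structure IsTridendriformFamilySubalgebra {E : Type*} [AddCommGroup E] [Module k E]
    (prec succ : Ω → E →ₗ[k] E →ₗ[k] E) (dot : E →ₗ[k] E →ₗ[k] E)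
    (S : Submodule k E) : Prop where
  prec_mem : ∀ ω, ∀ a ∈ S, ∀ b ∈ S, prec ω a b ∈ S
  succ_mem : ∀ ω, ∀ a ∈ S, ∀ b ∈ S, succ ω a b ∈ S
  dot_mem : ∀ a ∈ S, ∀ b ∈ S, dot a b ∈ S

/-- The operation `a ≺_ω b = a P_ω(b)`. -/
def inducedPrec {Ω : Type*} {A : Type*} [AddCommGroup A] [Module k A]
    (mul : A →ₗ[k] A →ₗ[k] A) (P : Ω → A →ₗ[k] A) (ω : Ω) : A →ₗ[k] A →ₗ[k] A :=
  mul.compl₂ (P ω)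

/-- The operation `a ≻_ω b = P_ω(a) b`. -/
def inducedSucc {Ω : Type*} {A : Type*} [AddCommGroup A] [Module k A]
    (mul : A →ₗ[k] A →ₗ[k] A) (P : Ω → A →ₗ[k] A) (ω : Ω) : A →ₗ[k] A →ₗ[k] A :=
  mul.comp (P ω)

end Abstract

/-- The bilinear extension of an operation given on a basis. -/
noncomputable def bilinearExtension {k : Type*} [CommRing k] {S : Type*}
    (op : S → S → (S →₀ k)) : (S →₀ k) →ₗ[k] (S →₀ k) →ₗ[k] (S →₀ k) :=
  Finsupp.linearCombination k (fun a => Finsupp.linearCombination k (op a))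

/-! # Typed angularly decorated planar rooted trees -/

/-- `X`-angularly decorated `Ω`-typed planar rooted trees (with at least one vertex), described
through the root vertex, whose incoming edges `b₁, …, bₙ₊₁` are listed from left to right and whose
angles carry the decorations `x₁, …, xₙ`, `n ≥ 0`:
`cons b₁ x₁ (cons b₂ x₂ (… (cons bₙ xₙ (single bₙ₊₁))))`.

An incoming edge is an element of `Option (Ω × PlanarTree X Ω)`: it is either a leaf `none` (the
tree `|`; leaves carry no type, equivalently the type `1`) or `some (ω, T)`, an internal edge of
type `ω ∈ Ω` that carries the tree `T`. -/
inductive PlanarTree (X Ω : Type*) where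
  | single (b : Option (Ω × PlanarTree X Ω)) : PlanarTree X Ω
  | cons (b : Option (Ω × PlanarTree X Ω)) (x : X) (T : PlanarTree X Ω) : PlanarTree X Ω

namespace PlanarTree

variable {k : Type*} [CommRing k] {X Ω : Type*}

/-- The tree with one vertex and one leaf. -/
def unit : PlanarTree X Ω := single none

/-- The tree with one vertex and two leaves, with angle `x`. -/
def corolla (x : X) : PlanarTree X Ω := cons none x (single none)

/-- Grafting on a new root by an internal edge of type `ω`. -/
def graft (ω : Ω) (T : PlanarTree X Ω) : PlanarTree X Ω := single (some (ω, T))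

/-- The product `T ⋄ T'` of two trees, for the weight `l`. The root vertices are identified, so that
the last incoming edge of `T` and the first incoming edge of `T'` meet. If one of the two is a leaf,
only the other one is kept. If they are internal edges `(α, S)` and `(β, S')`, they are replaced
by one internal edge of type `α * β` carrying
`B⁺_α(S) ⋄ S' + S ⋄ B⁺_β(S') + l • S ⋄ S'`, expanded linearly.
The first clause passes over the edges of `T` that are not the last one. -/
noncomputable def diamondBasis [Mul Ω] (l : k) :
    PlanarTree X Ω → PlanarTree X Ω → (PlanarTree X Ω →₀ k)
  | cons b x T, U => Finsupp.mapDomain (cons b x) (diamondBasis l T U)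
  | single none, U => Finsupp.single U 1
  | single (some (α, S)), single none => Finsupp.single (single (some (α, S))) 1
  | single (some (α, S)), cons none y V => Finsupp.single (cons (some (α, S)) y V) 1
  | single (some (α, S)), single (some (β, S')) =>
      Finsupp.mapDomain (fun R => single (some (α * β, R)))
        (diamondBasis l (graft α S) S' + diamondBasis l S (graft β S') + l • diamondBasis l S S')
  | single (some (α, S)), cons (some (β, S')) y V =>
      Finsupp.mapDomain (fun R => cons (some (α * β, R)) y V)
        (diamondBasis l (graft α S) S' + diamondBasis l S (graft β S') + l • diamondBasis l S S')
termination_by T U => sizeOf T + sizeOf U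
decreasing_by all_goals (simp [graft]; try omega)

/-- The product `⋄` on the free module on the trees. -/
noncomputable def diamond (k X Ω : Type*) [CommRing k] [Mul Ω] (l : k) :
    (PlanarTree X Ω →₀ k) →ₗ[k] (PlanarTree X Ω →₀ k) →ₗ[k] (PlanarTree X Ω →₀ k) :=
  bilinearExtension (diamondBasis l)

/-- The operator `B⁺_ω`. -/
noncomputable def graftOp (k X : Type*) [CommRing k] {Ω : Type*} (ω : Ω) :
    (PlanarTree X Ω →₀ k) →ₗ[k] (PlanarTree X Ω →₀ k) :=
  Finsupp.lmapDomain k k (graft ω)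

/-- The Schröder trees: every vertex has at least two incoming edges. -/
inductive IsSchroder : PlanarTree X Ω → Prop
  | pair {b : Option (Ω × PlanarTree X Ω)} {x : X} {c : Option (Ω × PlanarTree X Ω)}
      (hb : ∀ ω S, b = some (ω, S) → IsSchroder S)
      (hc : ∀ ω S, c = some (ω, S) → IsSchroder S) : IsSchroder (cons b x (single c))
  | cons {b : Option (Ω × PlanarTree X Ω)} {x : X} {T : PlanarTree X Ω}
      (hb : ∀ ω S, b = some (ω, S) → IsSchroder S)
      (hT : IsSchroder T) : IsSchroder (cons b x T)

/-- The span of the Schröder trees in the free module on all trees. -/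
def schroderSpan (k X Ω : Type*) [CommRing k] : Submodule k (PlanarTree X Ω →₀ k) :=
  Finsupp.supported k k {T | IsSchroder T}

end PlanarTree

/-! # Typed angularly decorated Schröder trees -/

/-- `X`-angularly decorated `Ω`-typed Schröder trees as a type of their own, described as
`PlanarTree`, except that every vertex has at least two incoming edges:
`cons b₁ x₁ (cons b₂ x₂ (… (pair bₙ xₙ bₙ₊₁)))` with `n ≥ 1`. -/
inductive SchroderTree (X Ω : Type*) where
  | pair (b : Option (Ω × SchroderTree X Ω)) (x : X) (c : Option (Ω × SchroderTree X Ω)) :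
      SchroderTree X Ω
  | cons (b : Option (Ω × SchroderTree X Ω)) (x : X) (T : SchroderTree X Ω) : SchroderTree X Ω

/-- Labels for the operations `≺_ω`, `≻_ω`, `·`. -/
inductive TriOp (Ω : Type*) where
  | prec (ω : Ω) : TriOp Ω
  | succ (ω : Ω) : TriOp Ω
  | dot : TriOp Ω

namespace SchroderTree

open TriOp

variable {k : Type*} [CommRing k] {X Ω : Type*}

/-- The tree with one vertex and two leaves, with angle `x`. -/
def corolla (x : X) : SchroderTree X Ω := pair none x none

/-- The recursive operations on Schröder trees.
* `T ≺_ω U` replaces the last incoming edge of the root of `T`: a leaf becomes `(ω, U)`, and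
  `(α, S)` becomes `(α * ω, S ≻_α U + S ≺_ω U + S · U)`.
* `T ≻_ω U` replaces the first incoming edge of the root of `U`: a leaf becomes `(ω, T)`, and
  `(β, V)` becomes `(ω * β, T ≻_ω V + T ≺_β V + T · V)`.
* `T · U` identifies the roots and merges the last incoming edge of `T` with the first one of `U`: if
  one of them is a leaf the other one is kept, and `(α, S)`, `(β, V)` become
  `(α * β, S ≻_α V + S ≺_β V + S · V)`. -/
noncomputable def opBasis (k : Type*) [CommRing k] [Mul Ω] :
    TriOp Ω → SchroderTree X Ω → SchroderTree X Ω → (SchroderTree X Ω →₀ k)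
  | prec ω, cons b x T, U => Finsupp.mapDomain (cons b x) (opBasis k (prec ω) T U)
  | prec ω, pair b x none, U => Finsupp.single (pair b x (some (ω, U))) 1
  | prec ω, pair b x (some (α, S)), U =>
      Finsupp.mapDomain (fun R => pair b x (some (α * ω, R)))
        (opBasis k (succ α) S U + opBasis k (prec ω) S U + opBasis k dot S U)
  | succ ω, T, pair none y c => Finsupp.single (pair (some (ω, T)) y c) 1
  | succ ω, T, cons none y U => Finsupp.single (cons (some (ω, T)) y U) 1
  | succ ω, T, pair (some (β, V)) y c =>
      Finsupp.mapDomain (fun R => pair (some (ω * β, R)) y c)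
        (opBasis k (succ ω) T V + opBasis k (prec β) T V + opBasis k dot T V)
  | succ ω, T, cons (some (β, V)) y U =>
      Finsupp.mapDomain (fun R => cons (some (ω * β, R)) y U)
        (opBasis k (succ ω) T V + opBasis k (prec β) T V + opBasis k dot T V)
  | dot, cons b x T, U => Finsupp.mapDomain (cons b x) (opBasis k dot T U)
  | dot, pair b x none, U => Finsupp.single (cons b x U) 1
  | dot, pair b x (some (α, S)), pair none y c =>
      Finsupp.single (cons b x (pair (some (α, S)) y c)) 1
  | dot, pair b x (some (α, S)), cons none y U =>
      Finsupp.single (cons b x (cons (some (α, S)) y U)) 1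
  | dot, pair b x (some (α, S)), pair (some (β, V)) y c =>
      Finsupp.mapDomain (fun R => cons b x (pair (some (α * β, R)) y c))
        (opBasis k (succ α) S V + opBasis k (prec β) S V + opBasis k dot S V)
  | dot, pair b x (some (α, S)), cons (some (β, V)) y U =>
      Finsupp.mapDomain (fun R => cons b x (cons (some (α * β, R)) y U))
        (opBasis k (succ α) S V + opBasis k (prec β) S V + opBasis k dot S V)
termination_by _ T U => sizeOf T + sizeOf U
decreasing_by all_goals (simp; try omega)

/-- The operation `≺_ω` on the free module on the Schröder trees. -/
noncomputable def precOp (k X : Type*) [CommRing k] {Ω : Type*} [Mul Ω] (ω : Ω) :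
    (SchroderTree X Ω →₀ k) →ₗ[k] (SchroderTree X Ω →₀ k) →ₗ[k] (SchroderTree X Ω →₀ k) :=
  bilinearExtension (opBasis k (prec ω))

/-- The operation `≻_ω` on the free module on the Schröder trees. -/
noncomputable def succOp (k X : Type*) [CommRing k] {Ω : Type*} [Mul Ω] (ω : Ω) :
    (SchroderTree X Ω →₀ k) →ₗ[k] (SchroderTree X Ω →₀ k) →ₗ[k] (SchroderTree X Ω →₀ k) :=
  bilinearExtension (opBasis k (succ ω))

/-- The operation `·` on the free module on the Schröder trees. -/
noncomputable def dotOp (k X Ω : Type*) [CommRing k] [Mul Ω] :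
    (SchroderTree X Ω →₀ k) →ₗ[k] (SchroderTree X Ω →₀ k) →ₗ[k] (SchroderTree X Ω →₀ k) :=
  bilinearExtension (opBasis k dot)

/-- A Schröder tree, seen as a planar rooted tree. -/
def toPlanar : SchroderTree X Ω → PlanarTree X Ω
  | pair none x none => .cons none x (.single none)
  | pair none x (some (β, S')) => .cons none x (.single (some (β, toPlanar S')))
  | pair (some (α, S)) x none => .cons (some (α, toPlanar S)) x (.single none)
  | pair (some (α, S)) x (some (β, S')) =>
      .cons (some (α, toPlanar S)) x (.single (some (β, toPlanar S')))
  | cons none x T => .cons none x (toPlanar T)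
  | cons (some (α, S)) x T => .cons (some (α, toPlanar S)) x (toPlanar T)

/-- The number of vertices. In the last two clauses the root of `T` is the root of the
whole tree. -/
def numVertices : SchroderTree X Ω → ℕ
  | pair none _ none => 1
  | pair none _ (some (_, S')) => 1 + numVertices S'
  | pair (some (_, S)) _ none => 1 + numVertices S
  | pair (some (_, S)) _ (some (_, S')) => 1 + numVertices S + numVertices S'
  | cons none _ T => numVertices T
  | cons (some (_, S)) _ T => numVertices S + numVertices T

/-- The canonical inclusion of the free module on the Schröder trees into the free module on all
trees. -/
noncomputable def inclusion (k X Ω : Type*) [CommRing k] :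
    (SchroderTree X Ω →₀ k) →ₗ[k] (PlanarTree X Ω →₀ k) :=
  Finsupp.lmapDomain k k toPlanar

/-- The canonical inclusion, rescaled by one factor `c` for each vertex: `T ↦ c ^ |V(T)| • T`. -/
noncomputable def rescaledInclusion (k X Ω : Type*) [CommRing k] (c : k) :
    (SchroderTree X Ω →₀ k) →ₗ[k] (PlanarTree X Ω →₀ k) :=
  Finsupp.linearCombination k (fun T => Finsupp.single (toPlanar T) (c ^ numVertices T))

end SchroderTree

/-!
In a Rota-Baxter family algebra, a tree whose angles are read as elements evaluates to a product of
these elements and of values `P_ω(S)`. Under `⋄` every tree is itself such a product of the `Y_x`,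
so evaluation is the only candidate for a morphism. Associativity of `⋄` follows from the
Rota-Baxter identity by induction on the sizes of the trees. In a tridendriform family algebra a
Schröder tree is evaluated in the same way by means of `≺_ω`, `≻_ω` and `·`.

In a Rota-Baxter family algebra of weight `λ` with `λ c = 1`, the evaluation of a Schröder tree `T`
for the induced operations at the elements `c f(x)` is `c ^ |V(T)|` times the Rota-Baxter
evaluation of `T` at the `f(x)`. Hence `j_λ` is the evaluation of Schröder trees at `λ⁻¹ Y_x` in
`k𝒯`, and it is a morphism. Since `j_1` is injective, the seven axioms of `DT(X, Ω)` need no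
verification of their own: they are those of `k𝒯`, pulled back along `j_1`.
-/

section Linear

variable {k : Type*} [CommRing k] {S S' E E' : Type*} [AddCommGroup E] [Module k E]
  [AddCommGroup E'] [Module k E']

theorem bilinearExtension_single (op : S → S → (S →₀ k)) (s t : S) :
    bilinearExtension op (Finsupp.single s 1) (Finsupp.single t 1) = op s t := by
  simp [bilinearExtension]

theorem map_bilinearExtension (F : (S →₀ k) →ₗ[k] E) (B : E →ₗ[k] E →ₗ[k] E)
    {op : S → S → (S →₀ k)}
    (h : ∀ s t, F (op s t) = B (F (Finsupp.single s 1)) (F (Finsupp.single t 1)))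
    (a b : S →₀ k) : F (bilinearExtension op a b) = B (F a) (F b) := by
  suffices (bilinearExtension op).compr₂ F = B.compl₁₂ F F from LinearMap.congr_fun₂ this a b
  ext s t
  simp [bilinearExtension_single, h]

theorem assoc_of_assoc_single {F G H K : (S →₀ k) →ₗ[k] (S →₀ k) →ₗ[k] (S →₀ k)}
    (h : ∀ s t u, F (G (Finsupp.single s 1) (Finsupp.single t 1)) (Finsupp.single u 1) =
      H (Finsupp.single s 1) (K (Finsupp.single t 1) (Finsupp.single u 1)))
    (a b c : S →₀ k) : F (G a b) c = H a (K b c) := by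
  suffices G.compr₂ F = ((LinearMap.llcomp k _ _ _).comp H).compl₂ K from
    LinearMap.congr_fun (LinearMap.congr_fun₂ this a b) c
  ext s t u : 6
  simp [h]

theorem linearCombination_mapDomain_of_forall {g : S → S'} {v : S → E} {v' : S' → E'}
    (L : E →ₗ[k] E') (h : ∀ s, v' (g s) = L (v s)) (a : S →₀ k) :
    Finsupp.linearCombination k v' (Finsupp.mapDomain g a) =
      L (Finsupp.linearCombination k v a) := by
  rw [Finsupp.linearCombination_mapDomain, Finsupp.apply_linearCombination]
  congr 2
  exact funext h

end Linear

section FamilyAlgebras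

variable {k Ω A D E : Type*} [CommRing k] [AddCommGroup A] [Module k A] [AddCommGroup D]
  [Module k D] [AddCommGroup E] [Module k E] {l : k} {mul : A →ₗ[k] A →ₗ[k] A} {one : A}
  {P : Ω → A →ₗ[k] A} {precD succD : Ω → D →ₗ[k] D →ₗ[k] D} {dotD : D →ₗ[k] D →ₗ[k] D}
  {precE succE : Ω → E →ₗ[k] E →ₗ[k] E} {dotE : E →ₗ[k] E →ₗ[k] E} {F : D →ₗ[k] E}

theorem mul_assoc_of_rotaBaxter [Semigroup Ω]
    (hP : ∀ α β a b,
      mul (P α a) (P β b) = P (α * β) (mul (P α a) b + mul a (P β b) + l • mul a b))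
    (α β γ : Ω) {a b c : A}
    (h₁ : mul (mul (P α a) (P β b)) c = mul (P α a) (mul (P β b) c))
    (h₂ : mul (mul (P α a) b) (P γ c) = mul (P α a) (mul b (P γ c)))
    (h₃ : mul (mul a (P β b)) (P γ c) = mul a (mul (P β b) (P γ c)))
    (h₄ : mul (mul (P α a) b) c = mul (P α a) (mul b c))
    (h₅ : mul (mul a (P β b)) c = mul a (mul (P β b) c))
    (h₆ : mul (mul a b) (P γ c) = mul a (mul b (P γ c)))
    (h₇ : mul (mul a b) c = mul a (mul b c)) :
    mul (mul (P α a) (P β b)) (P γ c) = mul (P α a) (mul (P β b) (P γ c)) := by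
  rw [hP α β, hP β γ, hP, hP, ← hP α β, ← hP β γ, mul_assoc]
  congr 1
  simp only [map_add, map_smul, LinearMap.add_apply, LinearMap.smul_apply, smul_add,
    h₁, h₂, h₃, h₄, h₅, h₆, h₇]
  abel

theorem IsRotaBaxterFamilyAlgebra.isTridendriformFamilyAlgebra [Semigroup Ω]
    (h : IsRotaBaxterFamilyAlgebra l mul one P) :
    IsTridendriformFamilyAlgebra (inducedPrec mul P) (inducedSucc mul P) (l • mul) where
  prec_prec α β x y z := by
    simp only [inducedPrec, inducedSucc, LinearMap.compl₂_apply, LinearMap.comp_apply,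
      LinearMap.smul_apply, h.mul_assoc, h.rotaBaxter, add_comm (mul (P α y) z)]
  succ_prec α β x y z := by
    simp only [inducedPrec, inducedSucc, LinearMap.compl₂_apply, LinearMap.comp_apply,
      h.mul_assoc]
  succ_succ α β x y z := by
    simp only [inducedPrec, inducedSucc, LinearMap.compl₂_apply, LinearMap.comp_apply,
      LinearMap.smul_apply, ← h.mul_assoc, h.rotaBaxter, add_comm (mul (P α x) y)]
  succ_dot α x y z := by
    simp only [inducedSucc, LinearMap.comp_apply, LinearMap.smul_apply, h.mul_assoc, map_smul]
  prec_dot α x y z := by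
    simp only [inducedPrec, inducedSucc, LinearMap.compl₂_apply, LinearMap.comp_apply,
      LinearMap.smul_apply, h.mul_assoc]
  dot_prec α x y z := by
    simp only [inducedPrec, LinearMap.compl₂_apply, LinearMap.smul_apply, map_smul, h.mul_assoc]
  dot_dot x y z := by
    simp only [LinearMap.smul_apply, map_smul, h.mul_assoc]

theorem IsTridendriformFamilyHom.isTridendriformFamilySubalgebra_range
    (h : IsTridendriformFamilyHom precD succD dotD precE succE dotE F) :
    IsTridendriformFamilySubalgebra precE succE dotE (LinearMap.range F) where
  prec_mem := by
    rintro ω _ ⟨a, rfl⟩ _ ⟨b, rfl⟩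
    exact ⟨_, h.map_prec ω a b⟩
  succ_mem := by
    rintro ω _ ⟨a, rfl⟩ _ ⟨b, rfl⟩
    exact ⟨_, h.map_succ ω a b⟩
  dot_mem := by
    rintro _ ⟨a, rfl⟩ _ ⟨b, rfl⟩
    exact ⟨_, h.map_dot a b⟩

theorem IsTridendriformFamilyAlgebra.of_injective [Semigroup Ω]
    (hE : IsTridendriformFamilyAlgebra precE succE dotE)
    (h : IsTridendriformFamilyHom precD succD dotD precE succE dotE F)
    (hF : Function.Injective F) : IsTridendriformFamilyAlgebra precD succD dotD where
  prec_prec α β x y z := hF <| by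
    simp only [h.map_prec, h.map_succ, h.map_dot, map_add F, hE.prec_prec]
  succ_prec α β x y z := hF <| by simp only [h.map_prec, h.map_succ, hE.succ_prec]
  succ_succ α β x y z := hF <| by
    simp only [h.map_prec, h.map_succ, h.map_dot, map_add F, hE.succ_succ]
  succ_dot α x y z := hF <| by simp only [h.map_dot, h.map_succ, hE.succ_dot]
  prec_dot α x y z := hF <| by simp only [h.map_dot, h.map_succ, h.map_prec, hE.prec_dot]
  dot_prec α x y z := hF <| by simp only [h.map_dot, h.map_prec, hE.dot_prec]
  dot_dot x y z := hF <| by simp only [h.map_dot, hE.dot_dot]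

end FamilyAlgebras

namespace PlanarTree

section Diamond

variable {k : Type*} [CommRing k] {X Ω : Type*}

@[simp]
theorem sizeOf_pos (T : PlanarTree X Ω) : 0 < sizeOf T := by
  cases T <;> simp

@[elab_as_elim]
theorem edge_induction {p : PlanarTree X Ω → Prop} (single_none : p (single none))
    (single_some : ∀ α S, p S → p (single (some (α, S))))
    (cons : ∀ b x T, p (single b) → p T → p (cons b x T)) : ∀ T, p T
  | single none => single_none
  | single (some (α, S)) => single_some α S (edge_induction single_none single_some cons S)
  | .cons b x T => cons b x T (edge_induction single_none single_some cons (single b))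
      (edge_induction single_none single_some cons T)
termination_by T => sizeOf T
decreasing_by all_goals simp <;> omega

/-- The tree obtained from `T` and `V` by identifying their roots, the edges of `T` standing to the
left of those of `V`, with a new angle `y` in between. -/
def append (y : X) : PlanarTree X Ω → PlanarTree X Ω → PlanarTree X Ω
  | single b, V => cons b y V
  | cons b x T, V => cons b x (append y T V)

theorem append_single (b : Option (Ω × PlanarTree X Ω)) (y : X) :
    append y (single b) = cons b y :=
  funext fun V => by rw [append]

theorem append_cons (b : Option (Ω × PlanarTree X Ω)) (x y : X) (T : PlanarTree X Ω) :
    append y (cons b x T) = cons b x ∘ append y T :=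
  funext fun V => by rw [append, Function.comp_apply]

theorem append_assoc (x y : X) (T U V : PlanarTree X Ω) :
    append y (append x T U) V = append x T (append y U V) := by
  induction T using edge_induction <;> simp_all [append]

/-- The bilinear extension of `append`. It commutes with `⋄` on both sides, which reduces the
computation of products to trees whose root has a single incoming edge. -/
noncomputable def appendOp (k Ω : Type*) [CommRing k] (y : X) :
    (PlanarTree X Ω →₀ k) →ₗ[k] (PlanarTree X Ω →₀ k) →ₗ[k] (PlanarTree X Ω →₀ k) :=
  bilinearExtension fun T V => Finsupp.single (append y T V) 1

theorem appendOp_single (y : X) (T V : PlanarTree X Ω) :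
    appendOp k Ω y (Finsupp.single T 1) (Finsupp.single V 1) = Finsupp.single (append y T V) 1 :=
  bilinearExtension_single _ _ _

theorem appendOp_single_left (y : X) (T : PlanarTree X Ω) (a : PlanarTree X Ω →₀ k) :
    appendOp k Ω y (Finsupp.single T 1) a = Finsupp.mapDomain (append y T) a := by
  suffices appendOp k Ω y (Finsupp.single T 1) = Finsupp.lmapDomain k k (append y T) from
    LinearMap.congr_fun this a
  ext V : 2
  simp [appendOp_single]

theorem appendOp_single_right (y : X) (V : PlanarTree X Ω) (a : PlanarTree X Ω →₀ k) :
    appendOp k Ω y a (Finsupp.single V 1) = Finsupp.mapDomain (append y · V) a := by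
  suffices (appendOp k Ω y).flip (Finsupp.single V 1) = Finsupp.lmapDomain k k (append y · V) from
    LinearMap.congr_fun this a
  ext T : 2
  simp [appendOp_single]

theorem single_cons_eq_appendOp (b : Option (Ω × PlanarTree X Ω)) (x : X) (T : PlanarTree X Ω) :
    Finsupp.single (cons b x T) (1 : k) =
      appendOp k Ω x (Finsupp.single (single b) 1) (Finsupp.single T 1) := by
  rw [appendOp_single, append]

theorem graftOp_single (α : Ω) (S : PlanarTree X Ω) :
    graftOp k X α (Finsupp.single S 1) = Finsupp.single (single (some (α, S))) 1 := by
  simp [graftOp, graft]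

variable [Mul Ω] (l : k)

theorem diamond_single (T U : PlanarTree X Ω) :
    diamond k X Ω l (Finsupp.single T 1) (Finsupp.single U 1) = diamondBasis l T U :=
  bilinearExtension_single _ _ _

theorem diamondBasis_append_left (y : X) (T U V : PlanarTree X Ω) :
    diamondBasis l (append y T U) V = Finsupp.mapDomain (append y T) (diamondBasis l U V) := by
  induction T using edge_induction with
  | single_none => rw [append_single, diamondBasis]
  | single_some => rw [append_single, diamondBasis]
  | cons b x T _ ih =>
    rw [append_cons, Function.comp_apply, diamondBasis, ih, Finsupp.mapDomain_comp]

theorem diamondBasis_cons_right (b : Option (Ω × PlanarTree X Ω)) (y : X)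
    (T V : PlanarTree X Ω) :
    diamondBasis l T (cons b y V) =
      Finsupp.mapDomain (append y · V) (diamondBasis l T (single b)) := by
  induction T using edge_induction with
  | single_none => simp [diamondBasis, append]
  | single_some α S =>
    rcases b with _ | ⟨β, S'⟩
    · simp [diamondBasis, append]
    · rw [diamondBasis, diamondBasis, ← Finsupp.mapDomain_comp]
      rfl
  | cons b x T _ ih =>
    rw [diamondBasis, ih, diamondBasis, ← Finsupp.mapDomain_comp, ← Finsupp.mapDomain_comp]
    rfl

theorem diamondBasis_append_right (y : X) (T U V : PlanarTree X Ω) :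
    diamondBasis l T (append y U V) =
      Finsupp.mapDomain (append y · V) (diamondBasis l T U) := by
  cases U with
  | single b => rw [append, diamondBasis_cons_right]
  | cons b x U =>
    rw [append, diamondBasis_cons_right, diamondBasis_cons_right, ← Finsupp.mapDomain_comp]
    exact congr_arg (Finsupp.mapDomain · _) (funext fun R => (append_assoc x y R U V).symm)

theorem diamond_appendOp_left (y : X) (a b c : PlanarTree X Ω →₀ k) :
    diamond k X Ω l (appendOp k Ω y a b) c = appendOp k Ω y a (diamond k X Ω l b c) :=
  assoc_of_assoc_single (fun T U V => by
    rw [appendOp_single, diamond_single, diamond_single, appendOp_single_left,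
      diamondBasis_append_left]) a b c

theorem diamond_appendOp_right (y : X) (a b c : PlanarTree X Ω →₀ k) :
    diamond k X Ω l a (appendOp k Ω y b c) = appendOp k Ω y (diamond k X Ω l a b) c :=
  Eq.symm <| assoc_of_assoc_single (fun T U V => by
    rw [appendOp_single, diamond_single, diamond_single, appendOp_single_right,
      diamondBasis_append_right]) a b c

theorem diamond_graftOp_graftOp (α β : Ω) (a b : PlanarTree X Ω →₀ k) :
    diamond k X Ω l (graftOp k X α a) (graftOp k X β b) =
      graftOp k X (α * β) (diamond k X Ω l (graftOp k X α a) b +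
        diamond k X Ω l a (graftOp k X β b) + l • diamond k X Ω l a b) := by
  suffices (diamond k X Ω l).compl₁₂ (graftOp k X α) (graftOp k X β) =
      ((diamond k X Ω l).comp (graftOp k X α) + (diamond k X Ω l).compl₂ (graftOp k X β) +
        l • diamond k X Ω l).compr₂ (graftOp k X (α * β)) from LinearMap.congr_fun₂ this a b
  ext S S' : 4
  simp only [LinearMap.compl₁₂_apply, LinearMap.compr₂_apply, LinearMap.add_apply,
    LinearMap.smul_apply, LinearMap.compl₂_apply, LinearMap.comp_apply, Finsupp.lsingle_apply,
    graftOp_single, diamond_single]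
  rw [diamondBasis]
  rfl

theorem unit_diamond (a : PlanarTree X Ω →₀ k) :
    diamond k X Ω l (Finsupp.single unit 1) a = a := by
  suffices diamond k X Ω l (Finsupp.single unit 1) = LinearMap.id from LinearMap.congr_fun this a
  ext U : 2
  simp [unit, diamond_single, diamondBasis]

theorem diamond_unit (a : PlanarTree X Ω →₀ k) :
    diamond k X Ω l a (Finsupp.single unit 1) = a := by
  suffices (diamond k X Ω l).flip (Finsupp.single unit 1) = LinearMap.id from
    LinearMap.congr_fun this a
  ext T : 2
  simp only [LinearMap.comp_apply, LinearMap.flip_apply, LinearMap.id_apply,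
    Finsupp.lsingle_apply, diamond_single, unit]
  induction T using edge_induction <;> simp_all [diamondBasis]

theorem single_cons_eq_diamond (b : Option (Ω × PlanarTree X Ω)) (x : X) (T : PlanarTree X Ω) :
    Finsupp.single (cons b x T) (1 : k) =
      diamond k X Ω l (Finsupp.single (single b) 1)
        (diamond k X Ω l (Finsupp.single (corolla x) 1) (Finsupp.single T 1)) := by
  rw [corolla, single_cons_eq_appendOp none, diamond_appendOp_left, diamond_appendOp_right]
  change _ = appendOp k Ω x (diamond k X Ω l _ (Finsupp.single unit 1))
    (diamond k X Ω l (Finsupp.single unit 1) _)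
  rw [diamond_unit, unit_diamond, single_cons_eq_appendOp]

end Diamond

section Eval

variable {k : Type*} [CommRing k] {X Ω R : Type*} [AddCommGroup R] [Module k R]
  (mulR : R →ₗ[k] R →ₗ[k] R) (oneR : R) (PR : Ω → R →ₗ[k] R) (f : X → R)

/-- The value in a Rota-Baxter family algebra of a tree whose angles are read as elements `f x`:
the edges of the root, a leaf being the unit and an edge of type `α` an application of `P_α`, are
multiplied from left to right with the angles in between. -/
def eval : PlanarTree X Ω → R
  | single none => oneR
  | single (some (α, S)) => PR α (eval S)
  | cons b x T => mulR (eval (single b)) (mulR (f x) (eval T))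
termination_by T => sizeOf T
decreasing_by all_goals simp <;> omega

theorem eval_single_none : eval mulR oneR PR f (single none : PlanarTree X Ω) = oneR := by
  rw [eval]

theorem eval_cons (b : Option (Ω × PlanarTree X Ω)) (x : X) (T : PlanarTree X Ω) :
    eval mulR oneR PR f (cons b x T) =
      mulR (eval mulR oneR PR f (single b)) (mulR (f x) (eval mulR oneR PR f T)) := by
  rw [eval]

/-- The linear extension of `eval`. -/
noncomputable def lift : (PlanarTree X Ω →₀ k) →ₗ[k] R :=
  Finsupp.linearCombination k (eval mulR oneR PR f)

theorem lift_single (T : PlanarTree X Ω) :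
    lift mulR oneR PR f (Finsupp.single T 1) = eval mulR oneR PR f T := by
  simp [lift]

theorem lift_mapDomain_of_forall {g : PlanarTree X Ω → PlanarTree X Ω} (L : R →ₗ[k] R)
    (h : ∀ T, eval mulR oneR PR f (g T) = L (eval mulR oneR PR f T)) (a : PlanarTree X Ω →₀ k) :
    lift mulR oneR PR f (Finsupp.mapDomain g a) = L (lift mulR oneR PR f a) :=
  linearCombination_mapDomain_of_forall L h a

end Eval

section RotaBaxter

variable {k : Type*} [CommRing k] {X Ω : Type*} [Semigroup Ω] (l : k)

theorem diamond_assoc_single (T U V : PlanarTree X Ω) :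
    diamond k X Ω l (diamond k X Ω l (Finsupp.single T 1) (Finsupp.single U 1))
      (Finsupp.single V 1) =
    diamond k X Ω l (Finsupp.single T 1)
      (diamond k X Ω l (Finsupp.single U 1) (Finsupp.single V 1)) := by
  match T, U, V with
  | cons b x T, U, V =>
    simp only [single_cons_eq_appendOp b, diamond_appendOp_left, diamond_assoc_single T U V]
  | single _, cons b x U, V =>
    simp only [single_cons_eq_appendOp b, diamond_appendOp_left, diamond_appendOp_right]
  | single c, single d, cons b x V =>
    simp only [single_cons_eq_appendOp b, diamond_appendOp_right,
      diamond_assoc_single (single c) (single d) (single b)]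
  | single none, single _, single _ => rw [← unit, unit_diamond, unit_diamond]
  | single (some _), single none, single _ => rw [← unit, diamond_unit, unit_diamond]
  | single (some _), single (some _), single none => rw [← unit, diamond_unit, diamond_unit]
  | single (some (α, S)), single (some (β, S')), single (some (γ, S'')) =>
    simp only [← graftOp_single]
    refine mul_assoc_of_rotaBaxter (diamond_graftOp_graftOp l) α β γ ?_ ?_ ?_ ?_ ?_ ?_
      (diamond_assoc_single S S' S'') <;> simp only [graftOp_single]
    · exact diamond_assoc_single _ _ S''
    · exact diamond_assoc_single _ S' _
    · exact diamond_assoc_single S _ _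
    · exact diamond_assoc_single _ S' S''
    · exact diamond_assoc_single S _ S''
    · exact diamond_assoc_single S S' _
termination_by sizeOf T + sizeOf U + sizeOf V
decreasing_by all_goals simp <;> omega

theorem isRotaBaxterFamilyAlgebra_diamond :
    IsRotaBaxterFamilyAlgebra l (diamond k X Ω l) (Finsupp.single unit 1) (graftOp k X) where
  mul_assoc := assoc_of_assoc_single (diamond_assoc_single l)
  one_mul := unit_diamond l
  mul_one := diamond_unit l
  rotaBaxter := diamond_graftOp_graftOp l

variable {l} {R : Type*} [AddCommGroup R] [Module k R] {mulR : R →ₗ[k] R →ₗ[k] R} {oneR : R}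
  {PR : Ω → R →ₗ[k] R} (f : X → R)

theorem eval_append (h : IsRotaBaxterFamilyAlgebra l mulR oneR PR) (y : X)
    (T V : PlanarTree X Ω) :
    eval mulR oneR PR f (append y T V) =
      mulR (eval mulR oneR PR f T) (mulR (f y) (eval mulR oneR PR f V)) := by
  induction T using edge_induction with
  | single_none => rw [append, eval_cons]
  | single_some => rw [append, eval_cons]
  | cons b x T _ ih => rw [append, eval_cons, ih, eval_cons, h.mul_assoc, h.mul_assoc]

theorem lift_diamondBasis (h : IsRotaBaxterFamilyAlgebra l mulR oneR PR) (T U : PlanarTree X Ω) :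
    lift mulR oneR PR f (diamondBasis l T U) =
      mulR (eval mulR oneR PR f T) (eval mulR oneR PR f U) := by
  match T, U with
  | cons b x T, U =>
    rw [diamondBasis, lift_mapDomain_of_forall _ _ _ _ (mulR _ ∘ₗ mulR (f x)) fun R => by
      rw [eval, LinearMap.comp_apply], LinearMap.comp_apply, lift_diamondBasis h, eval,
      h.mul_assoc, h.mul_assoc]
  | single c, cons b y V =>
    rw [diamondBasis_cons_right,
      lift_mapDomain_of_forall _ _ _ _ (mulR.flip (mulR (f y) (eval mulR oneR PR f V))) fun R => by
        rw [eval_append f h, LinearMap.flip_apply],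
      lift_diamondBasis h (single c) (single b), LinearMap.flip_apply, eval_cons, h.mul_assoc]
  | single none, single b => rw [diamondBasis, lift_single, eval_single_none, h.one_mul]
  | single (some _), single none => rw [diamondBasis, lift_single, eval_single_none, h.mul_one]
  | single (some (α, S)), single (some (β, S')) =>
    rw [diamondBasis, lift_mapDomain_of_forall _ _ _ _ (PR (α * β)) fun R => by rw [eval],
      eval, eval, h.rotaBaxter, map_add (lift ..), map_add (lift ..), map_smul (lift ..),
      lift_diamondBasis h (graft α S) S', lift_diamondBasis h S (graft β S'),
      lift_diamondBasis h S S', graft, graft, eval, eval]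
termination_by sizeOf T + sizeOf U
decreasing_by all_goals simp [graft] <;> omega

theorem isRotaBaxterFamilyHom_lift (h : IsRotaBaxterFamilyAlgebra l mulR oneR PR) :
    IsRotaBaxterFamilyHom (diamond k X Ω l) (Finsupp.single unit 1) (graftOp k X)
      mulR oneR PR (lift mulR oneR PR f) where
  map_mul := map_bilinearExtension _ _ fun T U => by
    rw [lift_single, lift_single, lift_diamondBasis f h]
  map_one := by rw [lift_single, unit, eval]
  map_op ω := lift_mapDomain_of_forall _ _ _ _ (PR ω) fun T => by rw [graft, eval]

theorem hom_single_eq_eval {F : (PlanarTree X Ω →₀ k) →ₗ[k] R}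
    (hF : IsRotaBaxterFamilyHom (diamond k X Ω l) (Finsupp.single unit 1) (graftOp k X)
      mulR oneR PR F) (T : PlanarTree X Ω) :
    F (Finsupp.single T 1) =
      eval mulR oneR PR (fun x => F (Finsupp.single (corolla x) 1)) T := by
  induction T using edge_induction with
  | single_none => rw [eval]; exact hF.map_one
  | single_some α S ih => rw [← graftOp_single, hF.map_op, ih, eval]
  | cons b x T ihb ih => rw [single_cons_eq_diamond l, hF.map_mul, hF.map_mul, ihb, ih, eval]

theorem eval_diamond (l : k) (T : PlanarTree X Ω) :
    eval (diamond k X Ω l) (Finsupp.single unit 1) (graftOp k X)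
      (fun x => Finsupp.single (corolla x) 1) T = Finsupp.single T 1 :=
  (hom_single_eq_eval (F := (LinearMap.id : (PlanarTree X Ω →₀ k) →ₗ[k] _))
    ⟨fun _ _ => rfl, rfl, fun _ _ => rfl⟩ T).symm

theorem isFreeRotaBaxterFamilyAlgebra_diamond (l : k) :
    IsFreeRotaBaxterFamilyAlgebra.{w} l (diamond k X Ω l) (Finsupp.single unit 1) (graftOp k X)
      (fun x : X => Finsupp.single (corolla x) 1) := by
  refine ⟨isRotaBaxterFamilyAlgebra_diamond l, fun R _ _ mulR oneR PR h f =>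
    ⟨lift mulR oneR PR f, ⟨isRotaBaxterFamilyHom_lift f h, fun x => ?_⟩, ?_⟩⟩
  · simp only [lift_single, corolla, eval, h.one_mul, h.mul_one]
  · rintro F ⟨hF, hf⟩
    ext T : 2
    simp only [LinearMap.comp_apply, Finsupp.lsingle_apply]
    rw [hom_single_eq_eval hF, lift_single, funext hf]

end RotaBaxter

end PlanarTree

namespace TriOp

/-- The operation with a given label in a tridendriform family algebra. -/
def interpret {k Ω E : Type*} [CommRing k] [AddCommGroup E] [Module k E]
    (prec succ : Ω → E →ₗ[k] E →ₗ[k] E) (dot : E →ₗ[k] E →ₗ[k] E) :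
    TriOp Ω → E →ₗ[k] E →ₗ[k] E
  | .prec ω => prec ω
  | .succ ω => succ ω
  | .dot => dot

end TriOp

namespace SchroderTree

open TriOp

section Eval

variable {k : Type*} [CommRing k] {X Ω E : Type*} [AddCommGroup E] [Module k E]
  (precE succE : Ω → E →ₗ[k] E →ₗ[k] E) (dotE : E →ₗ[k] E →ₗ[k] E) (f : X → E)

/-- The value in a tridendriform family algebra of a Schröder tree whose angles are read as
elements `f x`: an internal edge of type `α` acts by `≻_α` on what stands to its right, the last
edge of a vertex acts by `≺_β` on the angle to its left, and successive angles are joined by `·`. -/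
def eval : SchroderTree X Ω → E
  | pair none x none => f x
  | pair none x (some (β, S')) => precE β (f x) (eval S')
  | pair (some (α, S)) x c => succE α (eval S) (eval (pair none x c))
  | cons none x T => dotE (f x) (eval T)
  | cons (some (α, S)) x T => succE α (eval S) (eval (cons none x T))
termination_by T => sizeOf T
decreasing_by all_goals simp <;> omega

theorem eval_some_pair (α : Ω) (S : SchroderTree X Ω) (x : X)
    (c : Option (Ω × SchroderTree X Ω)) :
    eval precE succE dotE f (pair (some (α, S)) x c) =
      succE α (eval precE succE dotE f S) (eval precE succE dotE f (pair none x c)) := by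
  rw [eval]

theorem eval_some_cons (α : Ω) (S : SchroderTree X Ω) (x : X) (T : SchroderTree X Ω) :
    eval precE succE dotE f (cons (some (α, S)) x T) =
      succE α (eval precE succE dotE f S) (eval precE succE dotE f (cons none x T)) := by
  simp only [eval]

/-- The left action of an incoming edge on a tridendriform family algebra: the identity for a leaf,
`≻_α` by the value of `S` for an internal edge of type `α` carrying `S`. -/
def edgeAct : Option (Ω × SchroderTree X Ω) → E →ₗ[k] E
  | none => LinearMap.id
  | some (α, S) => succE α (eval precE succE dotE f S)

theorem eval_pair_none (b : Option (Ω × SchroderTree X Ω)) (x : X) :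
    eval precE succE dotE f (pair b x none) = edgeAct precE succE dotE f b (f x) := by
  rcases b with _ | ⟨α, S⟩ <;> simp [eval, edgeAct]

theorem eval_pair_some (b : Option (Ω × SchroderTree X Ω)) (x : X) (β : Ω)
    (S : SchroderTree X Ω) :
    eval precE succE dotE f (pair b x (some (β, S))) =
      edgeAct precE succE dotE f b (precE β (f x) (eval precE succE dotE f S)) := by
  rcases b with _ | ⟨α, S⟩ <;> simp [eval, edgeAct]

theorem eval_cons (b : Option (Ω × SchroderTree X Ω)) (x : X) (T : SchroderTree X Ω) :
    eval precE succE dotE f (cons b x T) =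
      edgeAct precE succE dotE f b (dotE (f x) (eval precE succE dotE f T)) := by
  rcases b with _ | ⟨α, S⟩ <;> simp [eval, edgeAct]

/-- The linear extension of `eval`. -/
noncomputable def lift : (SchroderTree X Ω →₀ k) →ₗ[k] E :=
  Finsupp.linearCombination k (eval precE succE dotE f)

theorem lift_single (T : SchroderTree X Ω) :
    lift precE succE dotE f (Finsupp.single T 1) = eval precE succE dotE f T := by
  simp [lift]

theorem lift_mapDomain_of_forall {g : SchroderTree X Ω → SchroderTree X Ω} (L : E →ₗ[k] E)
    (h : ∀ T, eval precE succE dotE f (g T) = L (eval precE succE dotE f T))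
    (a : SchroderTree X Ω →₀ k) :
    lift precE succE dotE f (Finsupp.mapDomain g a) = L (lift precE succE dotE f a) :=
  linearCombination_mapDomain_of_forall L h a

end Eval

section Operations

variable {k : Type*} [CommRing k] {X Ω : Type*} [Mul Ω]

theorem opBasis_dot_pair_some (b : Option (Ω × SchroderTree X Ω)) (x : X) (α : Ω)
    (S U : SchroderTree X Ω) :
    opBasis k dot (pair b x (some (α, S))) U =
      Finsupp.mapDomain (cons b x) (opBasis k (succ α) S U) := by
  rcases U with ⟨_ | ⟨β, V⟩, y, c⟩ | ⟨_ | ⟨β, V⟩, y, U⟩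
  · simp [opBasis]
  · rw [opBasis, opBasis, ← Finsupp.mapDomain_comp]
    rfl
  · simp [opBasis]
  · rw [opBasis, opBasis, ← Finsupp.mapDomain_comp]
    rfl

theorem precOp_corolla (ω : Ω) (x : X) (T : SchroderTree X Ω) :
    precOp k X ω (Finsupp.single (corolla x) 1) (Finsupp.single T 1) =
      Finsupp.single (pair none x (some (ω, T))) 1 := by
  rw [precOp, bilinearExtension_single, corolla, opBasis]

theorem dotOp_corolla (x : X) (T : SchroderTree X Ω) :
    dotOp k X Ω (Finsupp.single (corolla x) 1) (Finsupp.single T 1) =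
      Finsupp.single (cons none x T) 1 := by
  rw [dotOp, bilinearExtension_single, corolla, opBasis]

theorem succOp_pair_none (ω : Ω) (S : SchroderTree X Ω) (x : X)
    (c : Option (Ω × SchroderTree X Ω)) :
    succOp k X ω (Finsupp.single S 1) (Finsupp.single (pair none x c) 1) =
      Finsupp.single (pair (some (ω, S)) x c) 1 := by
  rw [succOp, bilinearExtension_single, opBasis]

theorem succOp_cons_none (ω : Ω) (S : SchroderTree X Ω) (x : X) (T : SchroderTree X Ω) :
    succOp k X ω (Finsupp.single S 1) (Finsupp.single (cons none x T) 1) =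
      Finsupp.single (cons (some (ω, S)) x T) 1 := by
  rw [succOp, bilinearExtension_single, opBasis]

end Operations

section Tridendriform

variable {k : Type*} [CommRing k] {X Ω E : Type*} [Semigroup Ω] [AddCommGroup E] [Module k E]
  {precE succE : Ω → E →ₗ[k] E →ₗ[k] E} {dotE : E →ₗ[k] E →ₗ[k] E} (f : X → E)

theorem prec_edgeAct (h : IsTridendriformFamilyAlgebra precE succE dotE)
    (b : Option (Ω × SchroderTree X Ω)) (ω : Ω) (u v : E) :
    precE ω (edgeAct precE succE dotE f b u) v =
      edgeAct precE succE dotE f b (precE ω u v) := by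
  rcases b with _ | ⟨α, S⟩ <;> simp [edgeAct, h.succ_prec]

theorem dot_edgeAct (h : IsTridendriformFamilyAlgebra precE succE dotE)
    (b : Option (Ω × SchroderTree X Ω)) (u v : E) :
    dotE (edgeAct precE succE dotE f b u) v =
      edgeAct precE succE dotE f b (dotE u v) := by
  rcases b with _ | ⟨α, S⟩ <;> simp [edgeAct, h.succ_dot]

theorem lift_mapDomain_of_eval_eq_succ (h : IsTridendriformFamilyAlgebra precE succE dotE)
    {g : SchroderTree X Ω → SchroderTree X Ω} {α β : Ω} {u v z : E} {a b c : SchroderTree X Ω →₀ k}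
    (hg : ∀ R, eval precE succE dotE f (g R) = succE (α * β) (eval precE succE dotE f R) z)
    (ha : lift precE succE dotE f a = succE α u v) (hb : lift precE succE dotE f b = precE β u v)
    (hc : lift precE succE dotE f c = dotE u v) :
    lift precE succE dotE f (Finsupp.mapDomain g (a + b + c)) = succE α u (succE β v z) := by
  rw [lift_mapDomain_of_forall _ _ _ _ ((succE (α * β)).flip z) hg, map_add (lift ..),
    map_add (lift ..), ha, hb, hc, add_comm (succE α u v), LinearMap.flip_apply, h.succ_succ]

theorem lift_opBasis (h : IsTridendriformFamilyAlgebra precE succE dotE) (o : TriOp Ω)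
    (T U : SchroderTree X Ω) :
    lift precE succE dotE f (opBasis k o T U) =
      o.interpret precE succE dotE (eval precE succE dotE f T) (eval precE succE dotE f U) := by
  match o, T, U with
  | prec ω, cons b x T, U =>
    rw [opBasis, lift_mapDomain_of_forall _ _ _ _ (edgeAct _ _ _ f b ∘ₗ dotE (f x))
        fun R => eval_cons .., lift_opBasis h (prec ω) T U, eval_cons]
    simp only [interpret, LinearMap.comp_apply, prec_edgeAct f h, h.dot_prec]
  | prec ω, pair b x none, U =>
    rw [opBasis, lift_single, eval_pair_none, eval_pair_some, interpret, prec_edgeAct f h]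
  | prec ω, pair b x (some (α, S)), U =>
    rw [opBasis, lift_mapDomain_of_forall _ _ _ _ (edgeAct _ _ _ f b ∘ₗ precE (α * ω) (f x))
        fun R => eval_pair_some .., map_add (lift ..), map_add (lift ..),
      lift_opBasis h (succ α) S U, lift_opBasis h (prec ω) S U, lift_opBasis h dot S U,
      eval_pair_some]
    simp only [interpret, LinearMap.comp_apply, prec_edgeAct f h, h.prec_prec,
      add_comm (succE α _ _)]
  | succ ω, T, pair none y c => rw [opBasis, lift_single, eval_some_pair, interpret]
  | succ ω, T, cons none y U => rw [opBasis, lift_single, eval_some_cons, interpret]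
  | succ ω, T, pair (some (β, V)) y c =>
    rw [opBasis, eval_some_pair]
    exact lift_mapDomain_of_eval_eq_succ f h (fun R => eval_some_pair ..)
      (lift_opBasis h (succ ω) T V) (lift_opBasis h (prec β) T V) (lift_opBasis h dot T V)
  | succ ω, T, cons (some (β, V)) y U =>
    rw [opBasis, eval_some_cons]
    exact lift_mapDomain_of_eval_eq_succ f h (fun R => eval_some_cons ..)
      (lift_opBasis h (succ ω) T V) (lift_opBasis h (prec β) T V) (lift_opBasis h dot T V)
  | dot, cons b x T, U =>
    rw [opBasis, lift_mapDomain_of_forall _ _ _ _ (edgeAct _ _ _ f b ∘ₗ dotE (f x))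
        fun R => eval_cons .., lift_opBasis h dot T U, eval_cons]
    simp only [interpret, LinearMap.comp_apply, dot_edgeAct f h, h.dot_dot]
  | dot, pair b x none, U =>
    rw [opBasis, lift_single, eval_pair_none, eval_cons, interpret, dot_edgeAct f h]
  | dot, pair b x (some (α, S)), U =>
    rw [opBasis_dot_pair_some,
      lift_mapDomain_of_forall _ _ _ _ (edgeAct _ _ _ f b ∘ₗ dotE (f x)) fun R => eval_cons ..,
      lift_opBasis h (succ α) S U, eval_pair_some]
    simp only [interpret, LinearMap.comp_apply, dot_edgeAct f h, h.prec_dot]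
termination_by sizeOf T + sizeOf U
decreasing_by all_goals simp <;> omega

theorem isTridendriformFamilyHom_lift (h : IsTridendriformFamilyAlgebra precE succE dotE) :
    IsTridendriformFamilyHom (precOp k X) (succOp k X) (dotOp k X Ω) precE succE dotE
      (lift precE succE dotE f) := by
  have map_op (o : TriOp Ω) (a b : SchroderTree X Ω →₀ k) :
      lift precE succE dotE f (bilinearExtension (opBasis k o) a b) =
        o.interpret precE succE dotE (lift precE succE dotE f a) (lift precE succE dotE f b) :=
    map_bilinearExtension _ _ (fun T U => by rw [lift_single, lift_single, lift_opBasis f h]) a b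
  exact ⟨fun ω => map_op (prec ω), fun ω => map_op (succ ω), map_op dot⟩

theorem hom_single_eq_eval {F : (SchroderTree X Ω →₀ k) →ₗ[k] E}
    (hF : IsTridendriformFamilyHom (precOp k X) (succOp k X) (dotOp k X Ω) precE succE dotE F) :
    ∀ T : SchroderTree X Ω, F (Finsupp.single T 1) =
      eval precE succE dotE (fun x => F (Finsupp.single (corolla x) 1)) T
  | pair none x none => by rw [eval, corolla]
  | pair none x (some (β, S')) => by
    rw [← precOp_corolla, hF.map_prec, hom_single_eq_eval hF S', eval]
  | pair (some (α, S)) x c => by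
    rw [← succOp_pair_none, hF.map_succ, hom_single_eq_eval hF S,
      hom_single_eq_eval hF (pair none x c), eval_some_pair]
  | cons none x T => by rw [← dotOp_corolla, hF.map_dot, hom_single_eq_eval hF T, eval]
  | cons (some (α, S)) x T => by
    rw [← succOp_cons_none, hF.map_succ, hom_single_eq_eval hF S,
      hom_single_eq_eval hF (cons none x T), eval_some_cons]
termination_by T => sizeOf T
decreasing_by all_goals simp <;> omega

end Tridendriform

section ToPlanar

variable {k : Type*} [CommRing k] {X Ω : Type*}

@[elab_as_elim]
theorem edge_induction {p : SchroderTree X Ω → Prop}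
    (pair : ∀ b x c, (∀ α S, b = some (α, S) → p S) → (∀ α S, c = some (α, S) → p S) →
      p (pair b x c))
    (cons : ∀ b x T, (∀ α S, b = some (α, S) → p S) → p T → p (cons b x T)) : ∀ T, p T
  | .pair b x c => pair b x c (fun _ S _ => edge_induction pair cons S)
      (fun _ S _ => edge_induction pair cons S)
  | .cons b x T => cons b x T (fun _ S _ => edge_induction pair cons S)
      (edge_induction pair cons T)
termination_by T => sizeOf T
decreasing_by all_goals simp_all <;> omega

theorem toPlanar_pair (b c : Option (Ω × SchroderTree X Ω)) (x : X) :
    toPlanar (pair b x c) = .cons (b.map (Prod.map id toPlanar)) x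
      (.single (c.map (Prod.map id toPlanar))) := by
  rcases b with _ | ⟨α, S⟩ <;> rcases c with _ | ⟨β, S'⟩ <;> simp [toPlanar]

theorem toPlanar_cons (b : Option (Ω × SchroderTree X Ω)) (x : X) (T : SchroderTree X Ω) :
    toPlanar (cons b x T) = .cons (b.map (Prod.map id toPlanar)) x (toPlanar T) := by
  rcases b with _ | ⟨α, S⟩ <;> simp [toPlanar]

theorem toPlanar_ne_single (T : SchroderTree X Ω) (b : Option (Ω × PlanarTree X Ω)) :
    toPlanar T ≠ .single b := by
  cases T <;> simp [toPlanar_pair, toPlanar_cons]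

theorem toPlanar_injective : Function.Injective (toPlanar : SchroderTree X Ω → _) := by
  have edge_eq {b b' : Option (Ω × SchroderTree X Ω)}
      (hb : ∀ α S, b = some (α, S) → ∀ ⦃S'⦄, toPlanar S = toPlanar S' → S = S')
      (h : b.map (Prod.map id toPlanar) = b'.map (Prod.map id toPlanar)) : b = b' := by
    match b, b' with
    | none, none => rfl
    | some (α, S), some (β, S') =>
      simp only [Option.map_some, Prod.map_apply, id, Option.some.injEq, Prod.mk.injEq] at h
      rw [h.1, hb α S rfl h.2]
  intro T
  induction T using edge_induction with
  | pair b x c hb hc =>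
    rintro (⟨b', y, c'⟩ | ⟨b', y, U⟩) h
    · simp only [toPlanar_pair, PlanarTree.cons.injEq, PlanarTree.single.injEq] at h
      rw [edge_eq hb h.1, h.2.1, edge_eq hc h.2.2]
    · simp only [toPlanar_pair, toPlanar_cons, PlanarTree.cons.injEq] at h
      exact absurd h.2.2.symm (toPlanar_ne_single _ _)
  | cons b x T hb ih =>
    rintro (⟨b', y, c'⟩ | ⟨b', y, U⟩) h
    · simp only [toPlanar_pair, toPlanar_cons, PlanarTree.cons.injEq] at h
      exact absurd h.2.2 (toPlanar_ne_single _ _)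
    · simp only [toPlanar_cons, PlanarTree.cons.injEq] at h
      rw [edge_eq hb h.1, h.2.1, ih h.2.2]

theorem isSchroder_toPlanar (T : SchroderTree X Ω) : (toPlanar T).IsSchroder := by
  induction T using edge_induction with
  | pair b x c hb hc => rw [toPlanar_pair]; exact .pair (by aesop) (by aesop)
  | cons b x T hb ih => rw [toPlanar_cons]; exact .cons (by aesop) ih

theorem exists_toPlanar_eq {T : PlanarTree X Ω} (hT : T.IsSchroder) :
    ∃ T' : SchroderTree X Ω, toPlanar T' = T := by
  have exists_edge {b : Option (Ω × PlanarTree X Ω)}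
      (hb : ∀ ω S, b = some (ω, S) → ∃ S' : SchroderTree X Ω, toPlanar S' = S) :
      ∃ b' : Option (Ω × SchroderTree X Ω), b'.map (Prod.map id toPlanar) = b := by
    rcases b with _ | ⟨α, S⟩
    · exact ⟨none, rfl⟩
    · obtain ⟨S', rfl⟩ := hb α S rfl
      exact ⟨some (α, S'), rfl⟩
  induction hT with
  | pair _ _ hb hc =>
    obtain ⟨b, rfl⟩ := exists_edge hb
    obtain ⟨c, rfl⟩ := exists_edge hc
    exact ⟨pair b _ c, toPlanar_pair _ _ _⟩
  | cons _ _ hb hT =>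
    obtain ⟨b, rfl⟩ := exists_edge hb
    obtain ⟨T, rfl⟩ := hT
    exact ⟨cons b _ T, toPlanar_cons _ _ _⟩

theorem range_toPlanar : Set.range (toPlanar : SchroderTree X Ω → _) = {T | T.IsSchroder} :=
  Set.Subset.antisymm (Set.range_subset_iff.2 isSchroder_toPlanar) fun _ => exists_toPlanar_eq

end ToPlanar

section Rescaling

variable {k : Type*} [CommRing k] {X Ω : Type*}

theorem numVertices_some_pair (α : Ω) (S : SchroderTree X Ω) (x : X)
    (c : Option (Ω × SchroderTree X Ω)) :
    numVertices (pair (some (α, S)) x c) = numVertices S + numVertices (pair none x c) := by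
  rcases c with _ | ⟨β, S'⟩ <;> simp only [numVertices] <;> omega

theorem inclusion_single (T : SchroderTree X Ω) (r : k) :
    inclusion k X Ω (Finsupp.single T r) = Finsupp.single (toPlanar T) r :=
  Finsupp.mapDomain_single

theorem inclusion_injective : Function.Injective (inclusion k X Ω) :=
  Finsupp.mapDomain_injective toPlanar_injective

theorem range_inclusion : LinearMap.range (inclusion k X Ω) = PlanarTree.schroderSpan k X Ω := by
  rw [inclusion, Finsupp.range_lmapDomain, PlanarTree.schroderSpan,
    Finsupp.supported_eq_span_single, ← range_toPlanar, ← Set.range_comp]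
  rfl

theorem rescaledInclusion_single (c : k) (T : SchroderTree X Ω) :
    rescaledInclusion k X Ω c (Finsupp.single T 1) =
      c ^ numVertices T • Finsupp.single (toPlanar T) 1 := by
  simp [rescaledInclusion]

theorem rescaledInclusion_one : rescaledInclusion k X Ω 1 = inclusion k X Ω := by
  ext T : 2
  simp [rescaledInclusion_single, inclusion_single]

theorem rescaledInclusion_corolla (c : k) (x : X) :
    rescaledInclusion k X Ω c (Finsupp.single (corolla x) 1) =
      c • inclusion k X Ω (Finsupp.single (corolla x) 1) := by
  simp [rescaledInclusion_single, inclusion_single, corolla, numVertices]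

/-- The automorphism `T ↦ c ^ |V(T)| • T` of the free module on the Schröder trees, for an
invertible `c`. -/
noncomputable def vertexScaling (X Ω : Type*) (c : kˣ) :
    (SchroderTree X Ω →₀ k) ≃ₗ[k] (SchroderTree X Ω →₀ k) :=
  (Finsupp.basisSingleOne.unitsSMul fun T => c ^ numVertices T).repr.symm

theorem inclusion_comp_vertexScaling (c : kˣ) :
    inclusion k X Ω ∘ₗ vertexScaling X Ω c = rescaledInclusion k X Ω c := by
  ext T : 2
  simp [vertexScaling, rescaledInclusion_single, inclusion_single, Module.Basis.unitsSMul_apply,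
    Units.smul_def]

theorem rescaledInclusion_injective (c : kˣ) :
    Function.Injective (rescaledInclusion k X Ω (c : k)) := by
  rw [← inclusion_comp_vertexScaling]
  exact inclusion_injective.comp (vertexScaling X Ω c).injective

theorem range_rescaledInclusion (c : kˣ) :
    LinearMap.range (rescaledInclusion k X Ω (c : k)) = PlanarTree.schroderSpan k X Ω := by
  rw [← inclusion_comp_vertexScaling,
    LinearMap.range_comp_of_range_eq_top _ (vertexScaling X Ω c).range, range_inclusion]

end Rescaling

section Embedding

open PlanarTree (diamond graftOp)

variable {k : Type*} [CommRing k] {X Ω : Type*} [Semigroup Ω] {l c : k}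

theorem eval_induced {R : Type*} [AddCommGroup R] [Module k R] {mulR : R →ₗ[k] R →ₗ[k] R}
    {oneR : R} {PR : Ω → R →ₗ[k] R} (h : IsRotaBaxterFamilyAlgebra l mulR oneR PR) (f : X → R)
    (hlc : l * c = 1) : ∀ T : SchroderTree X Ω,
    eval (inducedPrec mulR PR) (inducedSucc mulR PR) (l • mulR) (fun x => c • f x) T =
      c ^ numVertices T • PlanarTree.eval mulR oneR PR f (toPlanar T)
  | pair none x none => by
    simp [eval, numVertices, toPlanar, PlanarTree.eval, h.one_mul, h.mul_one]
  | pair none x (some (β, S')) => by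
    rw [eval, eval_induced h f hlc S']
    simp [numVertices, toPlanar, PlanarTree.eval, inducedPrec, h.one_mul, pow_add, smul_smul,
      mul_comm]
  | pair (some (α, S)) x b => by
    rw [eval, eval_induced h f hlc S, eval_induced h f hlc (pair none x b), numVertices_some_pair]
    simp [toPlanar_pair, PlanarTree.eval, inducedSucc, h.one_mul, pow_add, smul_smul, mul_comm]
  | cons none x T => by
    rw [eval, eval_induced h f hlc T]
    simp [numVertices, toPlanar, PlanarTree.eval, h.one_mul, smul_smul,
      mul_comm c l, hlc]
  | cons (some (α, S)) x T => by
    rw [eval, eval_induced h f hlc S, eval_induced h f hlc (cons none x T)]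
    simp [numVertices, toPlanar_cons, PlanarTree.eval, inducedSucc, h.one_mul, pow_add,
      smul_smul, mul_comm]
termination_by T => sizeOf T
decreasing_by all_goals simp <;> omega

variable (X Ω) in
theorem rescaledInclusion_eq_lift (hlc : l * c = 1) :
    rescaledInclusion k X Ω c =
      lift (inducedPrec (diamond k X Ω l) (graftOp k X))
        (inducedSucc (diamond k X Ω l) (graftOp k X)) (l • diamond k X Ω l)
        (fun x => c • Finsupp.single (PlanarTree.corolla x) 1) := by
  ext T : 2
  rw [LinearMap.comp_apply, LinearMap.comp_apply, Finsupp.lsingle_apply, lift_single,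
    eval_induced (PlanarTree.isRotaBaxterFamilyAlgebra_diamond l) _ hlc, PlanarTree.eval_diamond,
    rescaledInclusion_single]

theorem isTridendriformFamilyHom_rescaledInclusion (hlc : l * c = 1) :
    IsTridendriformFamilyHom (precOp k X) (succOp k X) (dotOp k X Ω)
      (inducedPrec (diamond k X Ω l) (graftOp k X)) (inducedSucc (diamond k X Ω l) (graftOp k X))
      (l • diamond k X Ω l) (rescaledInclusion k X Ω c) := by
  rw [rescaledInclusion_eq_lift X Ω hlc]
  exact isTridendriformFamilyHom_lift _
    (PlanarTree.isRotaBaxterFamilyAlgebra_diamond l).isTridendriformFamilyAlgebra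

theorem isTridendriformFamilyHom_inclusion :
    IsTridendriformFamilyHom (precOp k X) (succOp k X) (dotOp k X Ω)
      (inducedPrec (diamond k X Ω 1) (graftOp k X)) (inducedSucc (diamond k X Ω 1) (graftOp k X))
      (diamond k X Ω 1) (inclusion k X Ω) := by
  simpa only [one_smul, rescaledInclusion_one] using
    isTridendriformFamilyHom_rescaledInclusion (k := k) (X := X) (Ω := Ω) (mul_one 1)

end Embedding

theorem isFreeTridendriformFamilyAlgebra (k X Ω : Type*) [CommRing k] [Semigroup Ω] :
    IsFreeTridendriformFamilyAlgebra.{w} (precOp k X (Ω := Ω)) (succOp k X) (dotOp k X Ω)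
      (fun x : X => Finsupp.single (corolla x) 1) := by
  refine ⟨IsTridendriformFamilyAlgebra.of_injective
    (PlanarTree.isRotaBaxterFamilyAlgebra_diamond _).isTridendriformFamilyAlgebra
    (isTridendriformFamilyHom_rescaledInclusion (mul_one 1)) (rescaledInclusion_injective 1),
    fun E _ _ precE succE dotE h f => ⟨lift precE succE dotE f,
      ⟨isTridendriformFamilyHom_lift f h, fun x => by rw [lift_single, corolla, eval]⟩, ?_⟩⟩
  rintro F ⟨hF, hf⟩
  ext T : 2
  rw [LinearMap.comp_apply, LinearMap.comp_apply, Finsupp.lsingle_apply, hom_single_eq_eval hF,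
    lift_single, funext hf]

end SchroderTree

theorem theorem3p8 (k X Ω : Type*) [CommRing k] [Semigroup Ω] :
    -- the trees form the free Rota-Baxter family algebra of weight 1
    IsFreeRotaBaxterFamilyAlgebra.{w} (1 : k) (PlanarTree.diamond k X Ω 1)
      (Finsupp.single PlanarTree.unit 1) (PlanarTree.graftOp k X)
      (fun x : X => Finsupp.single (PlanarTree.corolla x) 1) ∧
    -- the Schröder trees form the free tridendriform family algebra
    IsFreeTridendriformFamilyAlgebra.{w} (SchroderTree.precOp k X (Ω := Ω))
      (SchroderTree.succOp k X) (SchroderTree.dotOp k X Ω)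
      (fun x : X => Finsupp.single (SchroderTree.corolla x) 1) ∧
    -- the induced operations of weight 1 on the span of all trees
    IsTridendriformFamilyAlgebra
      (inducedPrec (PlanarTree.diamond k X Ω 1) (PlanarTree.graftOp k X))
      (inducedSucc (PlanarTree.diamond k X Ω 1) (PlanarTree.graftOp k X))
      (PlanarTree.diamond k X Ω 1) ∧
    -- the span of the Schröder trees is a subalgebra for the induced operations ...
    IsTridendriformFamilySubalgebra
      (inducedPrec (PlanarTree.diamond k X Ω 1) (PlanarTree.graftOp k X))
      (inducedSucc (PlanarTree.diamond k X Ω 1) (PlanarTree.graftOp k X))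
      (PlanarTree.diamond k X Ω 1) (PlanarTree.schroderSpan k X Ω) ∧
    -- ... and the canonical inclusion identifies the free tridendriform family algebra with it
    IsTridendriformFamilyHom
      (SchroderTree.precOp k X) (SchroderTree.succOp k X) (SchroderTree.dotOp k X Ω)
      (inducedPrec (PlanarTree.diamond k X Ω 1) (PlanarTree.graftOp k X))
      (inducedSucc (PlanarTree.diamond k X Ω 1) (PlanarTree.graftOp k X))
      (PlanarTree.diamond k X Ω 1) (SchroderTree.inclusion k X Ω) ∧
    Function.Injective (SchroderTree.inclusion k X Ω) ∧
    LinearMap.range (SchroderTree.inclusion k X Ω) = PlanarTree.schroderSpan k X Ω ∧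
    (∀ x : X, SchroderTree.inclusion k X Ω (Finsupp.single (SchroderTree.corolla x) 1) =
      Finsupp.single (PlanarTree.corolla x) 1) ∧
    -- the same for every invertible weight `l`, with the inclusion rescaled
    ∀ l : kˣ,
      IsFreeRotaBaxterFamilyAlgebra.{w} (l : k) (PlanarTree.diamond k X Ω l)
        (Finsupp.single PlanarTree.unit 1) (PlanarTree.graftOp k X)
        (fun x : X => Finsupp.single (PlanarTree.corolla x) 1) ∧
      IsTridendriformFamilyAlgebra
        (inducedPrec (PlanarTree.diamond k X Ω l) (PlanarTree.graftOp k X))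
        (inducedSucc (PlanarTree.diamond k X Ω l) (PlanarTree.graftOp k X))
        ((l : k) • PlanarTree.diamond k X Ω l) ∧
      IsTridendriformFamilySubalgebra
        (inducedPrec (PlanarTree.diamond k X Ω l) (PlanarTree.graftOp k X))
        (inducedSucc (PlanarTree.diamond k X Ω l) (PlanarTree.graftOp k X))
        ((l : k) • PlanarTree.diamond k X Ω l) (PlanarTree.schroderSpan k X Ω) ∧
      IsTridendriformFamilyHom
        (SchroderTree.precOp k X) (SchroderTree.succOp k X) (SchroderTree.dotOp k X Ω)
        (inducedPrec (PlanarTree.diamond k X Ω l) (PlanarTree.graftOp k X))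
        (inducedSucc (PlanarTree.diamond k X Ω l) (PlanarTree.graftOp k X))
        ((l : k) • PlanarTree.diamond k X Ω l)
        (SchroderTree.rescaledInclusion k X Ω ((l⁻¹ : kˣ) : k)) ∧
      Function.Injective (SchroderTree.rescaledInclusion k X Ω ((l⁻¹ : kˣ) : k)) ∧
      LinearMap.range (SchroderTree.rescaledInclusion k X Ω ((l⁻¹ : kˣ) : k)) =
        PlanarTree.schroderSpan k X Ω ∧
      ∀ x : X, SchroderTree.rescaledInclusion k X Ω ((l⁻¹ : kˣ) : k)
          (Finsupp.single (SchroderTree.corolla x) 1) =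
        ((l⁻¹ : kˣ) : k) • SchroderTree.inclusion k X Ω
          (Finsupp.single (SchroderTree.corolla x) 1) := by
  have hRB (l : k) := PlanarTree.isRotaBaxterFamilyAlgebra_diamond (X := X) (Ω := Ω) l
  have hFree (l : k) := PlanarTree.isFreeRotaBaxterFamilyAlgebra_diamond.{w} (X := X) (Ω := Ω) l
  have hTri (l : k) := (hRB l).isTridendriformFamilyAlgebra
  refine ⟨hFree 1, SchroderTree.isFreeTridendriformFamilyAlgebra k X Ω, ?_, ?_,
    SchroderTree.isTridendriformFamilyHom_inclusion, SchroderTree.inclusion_injective,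
    SchroderTree.range_inclusion, fun x => ?_, fun l => ?_⟩
  · simpa only [one_smul] using hTri 1
  · rw [← SchroderTree.range_inclusion]
    exact SchroderTree.isTridendriformFamilyHom_inclusion.isTridendriformFamilySubalgebra_range
  · rw [SchroderTree.inclusion_single, SchroderTree.corolla, SchroderTree.toPlanar,
      PlanarTree.corolla]
  · have hHom := SchroderTree.isTridendriformFamilyHom_rescaledInclusion (X := X) (Ω := Ω)
      l.mul_inv
    have hRange := SchroderTree.range_rescaledInclusion (X := X) (Ω := Ω) l⁻¹
    exact ⟨hFree l, hTri l, hRange ▸ hHom.isTridendriformFamilySubalgebra_range, hHom,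
      SchroderTree.rescaledInclusion_injective l⁻¹, hRange,
      SchroderTree.rescaledInclusion_corolla _⟩
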